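/- Let $K$ be a field. An algebra with bracket (AWB) over $K$ is an associative, not necessarily unital or commutative, $K$-algebra $A$ with a bilinear bracket $[-,-]\colon A\times A\to A$ such that $[ab,c]=[a,c]b+a[b,c]$ for all $a,b,c\in A$. Homomorphisms of AWBs are the $K$-linear maps preserving product and bracket. Let $Z(A)=\{a\in A : ab=ba=[a,b]=[b,a]=0 \text{ for all } b\in A\}$ be the center. For two-sided ideals $I,J$ of $A$ let $[[I,J]]$ be the commutator ideal, generated by all $ij,\,ji,\,[i,j],\,[j,i]$ with $i\in I$, $j\in J$. Let $H_1(A)=\operatorname{Ker} d_1/\operatorname{Im} d_2$ be the first homology with trivial coefficients, where $A^{\otimes 3}\oplus A^{\otimes 3}\xrightarrow{d_2}A^{\otimes 2}\oplus A^{\otimes 2}\xrightarrow{d_1}A$ (tensors of the second summands are written with $\circ$) are given by $$d_1(a\otimes b)=ab,\quad d_1(a\circ b)=[a,b],\quad d_2(a\otimes b\otimes c)=ab\otimes c-a\otimes bc,\quad d_2(a\circ b\circ c)=[a,c]\otimes b+a\otimes[b,c]-ab\circ c.$$ Then for every AWB $Q$ there is a homomorphism $\theta_Q\colon H_1(Q/Z(Q))\to[[Q,Q]]$,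 and for every AWB $Q$ and every free presentation $0\to R\to F\xrightarrow{\rho}Q\to 0$ of $Q$ (that is, $F$ is a free AWB, $\rho$ is a surjective homomorphism and $R=\operatorname{Ker}\rho$) there is a homomorphism $\frac{R\cap[[F,F]]}{[[S,F]]}\to H_1(Q/Z(Q))$, where $S=\rho^{-1}(Z(Q))$, so that $S/R\cong Z(Q)$, such that the sequence $$0\to\frac{R\cap[[F,F]]}{[[S,F]]}\to H_1(Q/Z(Q))\xrightarrow{\theta_Q}[[Q,Q]]\xrightarrow{\pi'}[[Q/Z(Q),Q/Z(Q)]]\to 0$$ is exact, where $\pi'$ is the restriction of the canonical projection $\pi\colon Q\to Q/Z(Q)$. Moreover the sequence is natural: if $f\colon Q\to Q'$ is a homomorphism of AWBs with $f(Z(Q))\subseteq Z(Q')$, then the squares formed by $\theta_Q,\theta_{Q'}$ and by $\pi'_Q,\pi'_{Q'}$ with the maps induced by $f$ commute; and if $F\to Q$ and $F'\to Q'$ are free presentations and $g\colon F\to F'$ is any homomorphism lifting $f$, then the square formed by the first maps of the two sequences, the map $\frac{R\cap[[F,F]]}{[[S,F]]}\to\frac{R'\cap[[F',F']]}{[[S',F']]}$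 induced by $g$ and the map $H_1(Q/Z(Q))\to H_1(Q'/Z(Q'))$ induced by $f$ commutes. -/

import Mathlib

open scoped TensorProduct

/-- An algebra with bracket over a field `K`: a (not necessarily unital or commutative) associative
`K`-algebra with a bilinear bracket satisfying `[ab, c] = [a, c] b + a [b, c]`. -/
class AWB (K : Type*) [Field K] (A : Type*) [AddCommGroup A] [Module K A] where
  /-- the product `a b` -/
  mul : A →ₗ[K] A →ₗ[K] A
  /-- the bracket `[a, b]` -/
  br : A →ₗ[K] A →ₗ[K] A
  mul_assoc : ∀ a b c : A, mul (mul a b) c = mul a (mul b c)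
  br_mul : ∀ a b c : A, br (mul a b) c = mul (br a c) b + mul a (br b c)

/-- Homomorphisms of algebras with bracket. -/
structure AWBHom (K : Type*) [Field K] (A B : Type*) [AddCommGroup A] [Module K A] [AWB K A]
    [AddCommGroup B] [Module K B] [AWB K B] extends A →ₗ[K] B where
  map_mul : ∀ a b : A, toFun (AWB.mul (K := K) a b) = AWB.mul (K := K) (toFun a) (toFun b)
  map_br : ∀ a b : A, toFun (AWB.br (K := K) a b) = AWB.br (K := K) (toFun a) (toFun b)

/-- Two-sided ideals of an algebra with bracket. -/
structure AWBIdeal (K : Type*) [Field K] (A : Type*) [AddCommGroup A] [Module K A] [AWB K A]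
    extends Submodule K A where
  mul_left_mem : ∀ (a x : A), x ∈ toSubmodule → AWB.mul (K := K) a x ∈ toSubmodule
  mul_right_mem : ∀ (a x : A), x ∈ toSubmodule → AWB.mul (K := K) x a ∈ toSubmodule
  br_left_mem : ∀ (a x : A), x ∈ toSubmodule → AWB.br (K := K) a x ∈ toSubmodule
  br_right_mem : ∀ (a x : A), x ∈ toSubmodule → AWB.br (K := K) x a ∈ toSubmodule

namespace AWB

/-- The bilinear operation induced on `A ⧸ I` by a bilinear operation `m` on `A` for which `I` is
stable under `m a ·` and `m · a`. -/
def quotOp {K A : Type*} [Field K] [AddCommGroup A] [Module K A] (m : A →ₗ[K] A →ₗ[K] A)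
    (I : Submodule K A) (hl : ∀ a x : A, x ∈ I → m a x ∈ I) (hr : ∀ a x : A, x ∈ I → m x a ∈ I) :
    (A ⧸ I) →ₗ[K] (A ⧸ I) →ₗ[K] (A ⧸ I) :=
  I.liftQ
    (LinearMap.mk₂ K (fun (a : A) (y : A ⧸ I) => I.mapQ I (m a) (fun x hx => hl a x hx) y)
      (by
        intro a b y
        induction y using Submodule.Quotient.induction_on with
        | _ y => simp)
      (by
        intro c a y
        induction y using Submodule.Quotient.induction_on with
        | _ y => simp)
      (by intro a y z; simp)
      (by intro c a y; simp))
    (by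
      intro x hx
      rw [LinearMap.mem_ker]
      ext y
      simpa using hr y x hx)

@[simp]
theorem quotOp_mk {K A : Type*} [Field K] [AddCommGroup A] [Module K A] (m : A →ₗ[K] A →ₗ[K] A)
    (I : Submodule K A) (hl : ∀ a x : A, x ∈ I → m a x ∈ I) (hr : ∀ a x : A, x ∈ I → m x a ∈ I)
    (a b : A) :
    quotOp m I hl hr (Submodule.Quotient.mk a) (Submodule.Quotient.mk b)
      = Submodule.Quotient.mk (m a b) :=
  rfl

/-- The quotient of an algebra with bracket by a two-sided ideal. -/
instance quotient {K A : Type*} [Field K] [AddCommGroup A] [Module K A] [AWB K A]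
    (I : AWBIdeal K A) : AWB K (A ⧸ I.toSubmodule) where
  mul := quotOp (mul (K := K)) I.toSubmodule I.mul_left_mem I.mul_right_mem
  br := quotOp (br (K := K)) I.toSubmodule I.br_left_mem I.br_right_mem
  mul_assoc := by
    intro a b c
    induction a using Submodule.Quotient.induction_on with
    | _ a =>
      induction b using Submodule.Quotient.induction_on with
      | _ b =>
        induction c using Submodule.Quotient.induction_on with
        | _ c => simp [mul_assoc]
  br_mul := by
    intro a b c
    induction a using Submodule.Quotient.induction_on with
    | _ a =>
      induction b using Submodule.Quotient.induction_on with
      | _ b =>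
        induction c using Submodule.Quotient.induction_on with
        | _ c => simp [br_mul]

/-- The center `Z(A)`. -/
def center (K A : Type*) [Field K] [AddCommGroup A] [Module K A] [AWB K A] : AWBIdeal K A where
  carrier := {a | ∀ b : A, mul (K := K) a b = 0 ∧ mul (K := K) b a = 0 ∧ br (K := K) a b = 0 ∧ br (K := K) b a = 0}
  zero_mem' := by intro b; simp
  add_mem' := by
    intro x y hx hy b
    obtain ⟨h1, h2, h3, h4⟩ := hx b
    obtain ⟨k1, k2, k3, k4⟩ := hy b
    simp [h1, h2, h3, h4, k1, k2, k3, k4]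
  smul_mem' := by
    intro c x hx b
    obtain ⟨h1, h2, h3, h4⟩ := hx b
    simp [h1, h2, h3, h4]
  mul_left_mem := by intro a x hx b; rw [(hx a).2.1]; simp
  mul_right_mem := by intro a x hx b; rw [(hx a).1]; simp
  br_left_mem := by intro a x hx b; rw [(hx a).2.2.2]; simp
  br_right_mem := by intro a x hx b; rw [(hx a).2.2.1]; simp

/-- The commutator ideal `[[I, J]]` of two-sided ideals `I`, `J` of `A` (given by their underlying
subspaces), generated by `ij`, `ji`, `[i, j]`, `[j, i]`. For two-sided ideals `I`, `J` the linear
span of these elements is already stable under all operations with elements of `I` and of `J`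
(see `commutator_stable`), so it is the ideal generated by them. -/
def commutator (K : Type*) {A : Type*} [Field K] [AddCommGroup A] [Module K A] [AWB K A]
    (I J : Submodule K A) : Submodule K A :=
  Submodule.span K
    {x | ∃ i ∈ I, ∃ j ∈ J, x = mul (K := K) i j ∨ x = mul (K := K) j i ∨ x = br (K := K) i j ∨ x = br (K := K) j i}

/-- `[[I, J]] ⊆ I ∩ J`. -/
theorem commutator_le {K A : Type*} [Field K] [AddCommGroup A] [Module K A] [AWB K A]
    (I J : AWBIdeal K A) :
    commutator K I.toSubmodule J.toSubmodule ≤ I.toSubmodule ⊓ J.toSubmodule := by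
  refine Submodule.span_le.2 ?_
  rintro x ⟨i, hi, j, hj, rfl | rfl | rfl | rfl⟩
  · exact ⟨I.mul_right_mem _ _ hi, J.mul_left_mem _ _ hj⟩
  · exact ⟨I.mul_left_mem _ _ hi, J.mul_right_mem _ _ hj⟩
  · exact ⟨I.br_right_mem _ _ hi, J.br_left_mem _ _ hj⟩
  · exact ⟨I.br_left_mem _ _ hi, J.br_right_mem _ _ hj⟩

/-- `[[I, J]]` is stable under all operations with elements of `I` and of `J`. In particular it is
a two-sided ideal of `A` if `I` or `J` is all of `A`. -/
theorem commutator_stable {K A : Type*} [Field K] [AddCommGroup A] [Module K A] [AWB K A]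
    (I J : AWBIdeal K A) (a x : A) (ha : a ∈ I.toSubmodule ∨ a ∈ J.toSubmodule)
    (hx : x ∈ commutator K I.toSubmodule J.toSubmodule) :
    mul (K := K) a x ∈ commutator K I.toSubmodule J.toSubmodule ∧
    mul (K := K) x a ∈ commutator K I.toSubmodule J.toSubmodule ∧
    br (K := K) a x ∈ commutator K I.toSubmodule J.toSubmodule ∧
    br (K := K) x a ∈ commutator K I.toSubmodule J.toSubmodule := by
  obtain ⟨hI, hJ⟩ := commutator_le I J hx
  rcases ha with ha | ha
  · exact ⟨Submodule.subset_span ⟨a, ha, x, hJ, by simp⟩,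
      Submodule.subset_span ⟨a, ha, x, hJ, by simp⟩,
      Submodule.subset_span ⟨a, ha, x, hJ, by simp⟩,
      Submodule.subset_span ⟨a, ha, x, hJ, by simp⟩⟩
  · exact ⟨Submodule.subset_span ⟨x, hI, a, ha, by simp⟩,
      Submodule.subset_span ⟨x, hI, a, ha, by simp⟩,
      Submodule.subset_span ⟨x, hI, a, ha, by simp⟩,
      Submodule.subset_span ⟨x, hI, a, ha, by simp⟩⟩

/-- A homomorphism `f` with `f I ⊆ I'` and `f J ⊆ J'` maps `[[I, J]]` into `[[I', J']]`. -/
theorem commutator_le_comap {K A B : Type*} [Field K] [AddCommGroup A] [Module K A] [AWB K A]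
    [AddCommGroup B] [Module K B] [AWB K B] (f : AWBHom K A B) {I J : Submodule K A}
    {I₂ J₂ : Submodule K B} (hI : I ≤ I₂.comap f.toLinearMap) (hJ : J ≤ J₂.comap f.toLinearMap) :
    commutator K I J ≤ (commutator K I₂ J₂).comap f.toLinearMap := by
  refine Submodule.span_le.2 ?_
  rintro x ⟨i, hi, j, hj, h⟩
  refine Submodule.subset_span ⟨f.toLinearMap i, hI hi, f.toLinearMap j, hJ hj, ?_⟩
  rcases h with rfl | rfl | rfl | rfl
  · exact Or.inl (f.map_mul _ _)
  · exact Or.inr (Or.inl (f.map_mul _ _))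
  · exact Or.inr (Or.inr (Or.inl (f.map_br _ _)))
  · exact Or.inr (Or.inr (Or.inr (f.map_br _ _)))

/-- The derived algebra `[[A, A]]`. -/
def derived (K A : Type*) [Field K] [AddCommGroup A] [Module K A] [AWB K A] : Submodule K A :=
  commutator K (⊤ : Submodule K A) (⊤ : Submodule K A)

/-- The restriction `[[A, A]] → [[B, B]]` of a homomorphism `A → B`. -/
def derivedMap {K A B : Type*} [Field K] [AddCommGroup A] [Module K A] [AWB K A]
    [AddCommGroup B] [Module K B] [AWB K B] (f : AWBHom K A B) :
    derived K A →ₗ[K] derived K B :=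
  f.toLinearMap.restrict (p := derived K A) (q := derived K B)
    (fun _ hx => commutator_le_comap f le_top le_top hx)

/-- The canonical projection `A → A / I`. -/
def proj {K A : Type*} [Field K] [AddCommGroup A] [Module K A] [AWB K A] (I : AWBIdeal K A) :
    AWBHom K A (A ⧸ I.toSubmodule) where
  toLinearMap := I.toSubmodule.mkQ
  map_mul _ _ := rfl
  map_br _ _ := rfl

/-- The homomorphism `A / I → B / J` induced by a homomorphism `f : A → B` with `f I ⊆ J`. -/
def quotientMap {K A B : Type*} [Field K] [AddCommGroup A] [Module K A] [AWB K A]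
    [AddCommGroup B] [Module K B] [AWB K B] (f : AWBHom K A B) (I : AWBIdeal K A)
    (J : AWBIdeal K B) (h : I.toSubmodule ≤ J.toSubmodule.comap f.toLinearMap) :
    AWBHom K (A ⧸ I.toSubmodule) (B ⧸ J.toSubmodule) where
  toLinearMap := I.toSubmodule.mapQ J.toSubmodule f.toLinearMap h
  map_mul := by
    intro a b
    induction a using Submodule.Quotient.induction_on with
    | _ a =>
      induction b using Submodule.Quotient.induction_on with
      | _ b => exact congrArg Submodule.Quotient.mk (f.map_mul a b)
  map_br := by
    intro a b
    induction a using Submodule.Quotient.induction_on with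
    | _ a =>
      induction b using Submodule.Quotient.induction_on with
      | _ b => exact congrArg Submodule.Quotient.mk (f.map_br a b)

/-! ### Homology with trivial coefficients

The part `C₂ → C₁ → C₀` of the complex, where `C₀ = A`, `C₁ = A^{⊗2} ⊕ A^{⊗2}` and
`C₂ = A^{⊗3} ⊕ A^{⊗3}`. The first summand holds the tensors written `a ⊗ b`, `a ⊗ b ⊗ c`, the second
summand those written `a ∘ b`, `a ∘ b ∘ c`. -/

/-- `C₁(A)`. -/
abbrev C1 (K A : Type*) [Field K] [AddCommGroup A] [Module K A] : Type _ :=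
  (A ⊗[K] A) × (A ⊗[K] A)

/-- `C₂(A)`. -/
abbrev C2 (K A : Type*) [Field K] [AddCommGroup A] [Module K A] : Type _ :=
  ((A ⊗[K] A) ⊗[K] A) × ((A ⊗[K] A) ⊗[K] A)

/-- `d₁(a ⊗ b) = ab` and `d₁(a ∘ b) = [a, b]`. -/
noncomputable def d1 (K A : Type*) [Field K] [AddCommGroup A] [Module K A] [AWB K A] :
    C1 K A →ₗ[K] A :=
  LinearMap.coprod (TensorProduct.lift (mul (K := K))) (TensorProduct.lift (br (K := K)))

/-- The component of `d₂` on `a ⊗ b ⊗ c`: `d₂(a ⊗ b ⊗ c) = ab ⊗ c - a ⊗ bc`. -/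
noncomputable def d2Tensor (K A : Type*) [Field K] [AddCommGroup A] [Module K A] [AWB K A] :
    (A ⊗[K] A) ⊗[K] A →ₗ[K] C1 K A :=
  TensorProduct.lift (TensorProduct.lift
    (LinearMap.mk₂ K
      (fun a b : A => (LinearMap.inl K (A ⊗[K] A) (A ⊗[K] A)) ∘ₗ
        (TensorProduct.mk K A A (mul (K := K) a b) - TensorProduct.mk K A A a ∘ₗ mul (K := K) b))
      (by intro a a₂ b; ext c <;> simp; abel)
      (by intro r a b; ext c <;> simp [TensorProduct.smul_tmul', smul_sub])
      (by intro a b b₂; ext c <;> simp [TensorProduct.tmul_add]; abel)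
      (by intro r a b; ext c <;> simp [TensorProduct.smul_tmul', smul_sub])))

/-- The component of `d₂` on `a ∘ b ∘ c`:
`d₂(a ∘ b ∘ c) = [a, c] ⊗ b + a ⊗ [b, c] - ab ∘ c`. -/
noncomputable def d2Circ (K A : Type*) [Field K] [AddCommGroup A] [Module K A] [AWB K A] :
    (A ⊗[K] A) ⊗[K] A →ₗ[K] C1 K A :=
  TensorProduct.lift (TensorProduct.lift
    (LinearMap.mk₂ K
      (fun a b : A =>
        (LinearMap.inl K (A ⊗[K] A) (A ⊗[K] A)) ∘ₗ
          ((TensorProduct.mk K A A).flip b ∘ₗ br (K := K) a + TensorProduct.mk K A A a ∘ₗ br (K := K) b)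
        - (LinearMap.inr K (A ⊗[K] A) (A ⊗[K] A)) ∘ₗ TensorProduct.mk K A A (mul (K := K) a b))
      (by intro a a₂ b; ext c <;> simp <;> abel)
      (by intro r a b; ext c <;> simp [TensorProduct.smul_tmul'])
      (by intro a b b₂; ext c <;> simp [TensorProduct.tmul_add] <;> abel)
      (by intro r a b; ext c <;> simp [TensorProduct.smul_tmul'])))

/-- `d₂ : C₂(A) → C₁(A)`. -/
noncomputable def d2 (K A : Type*) [Field K] [AddCommGroup A] [Module K A] [AWB K A] :
    C2 K A →ₗ[K] C1 K A :=
  LinearMap.coprod (d2Tensor K A) (d2Circ K A)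

@[simp]
theorem d1_apply {K A : Type*} [Field K] [AddCommGroup A] [Module K A] [AWB K A] (a b c d : A) :
    d1 K A (a ⊗ₜ[K] b, c ⊗ₜ[K] d) = mul (K := K) a b + br (K := K) c d := by
  simp [d1]

@[simp]
theorem d2Tensor_apply {K A : Type*} [Field K] [AddCommGroup A] [Module K A] [AWB K A]
    (a b c : A) :
    d2Tensor K A ((a ⊗ₜ[K] b) ⊗ₜ[K] c) = (mul (K := K) a b ⊗ₜ[K] c - a ⊗ₜ[K] mul (K := K) b c, 0) := by
  simp [d2Tensor]

@[simp]
theorem d2Circ_apply {K A : Type*} [Field K] [AddCommGroup A] [Module K A] [AWB K A]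
    (a b c : A) :
    d2Circ K A ((a ⊗ₜ[K] b) ⊗ₜ[K] c)
      = (br (K := K) a c ⊗ₜ[K] b + a ⊗ₜ[K] br (K := K) b c, -(mul (K := K) a b ⊗ₜ[K] c)) := by
  simp [d2Circ]

theorem d1_comp_d2 (K A : Type*) [Field K] [AddCommGroup A] [Module K A] [AWB K A] :
    d1 K A ∘ₗ d2 K A = 0 := by
  ext a b c
  · simp [d2, d1, mul_assoc]
  · simp [d2, d1, br_mul]

/-- `H₁(A) = Ker d₁ / Im d₂`, the first homology with trivial coefficients. -/
abbrev H1 (K A : Type*) [Field K] [AddCommGroup A] [Module K A] [AWB K A] : Type _ :=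
  LinearMap.ker (d1 K A) ⧸ (LinearMap.range (d2 K A)).submoduleOf (LinearMap.ker (d1 K A))

/-- The map `C₁(A) → C₁(B)` induced by a homomorphism. -/
noncomputable def C1Map {K A B : Type*} [Field K] [AddCommGroup A] [Module K A] [AWB K A]
    [AddCommGroup B] [Module K B] [AWB K B] (f : AWBHom K A B) : C1 K A →ₗ[K] C1 K B :=
  LinearMap.prodMap (TensorProduct.map f.toLinearMap f.toLinearMap)
    (TensorProduct.map f.toLinearMap f.toLinearMap)

/-- The map `C₂(A) → C₂(B)` induced by a homomorphism. -/
noncomputable def C2Map {K A B : Type*} [Field K] [AddCommGroup A] [Module K A] [AWB K A]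
    [AddCommGroup B] [Module K B] [AWB K B] (f : AWBHom K A B) : C2 K A →ₗ[K] C2 K B :=
  LinearMap.prodMap
    (TensorProduct.map (TensorProduct.map f.toLinearMap f.toLinearMap) f.toLinearMap)
    (TensorProduct.map (TensorProduct.map f.toLinearMap f.toLinearMap) f.toLinearMap)

theorem d1_comp_C1Map {K A B : Type*} [Field K] [AddCommGroup A] [Module K A] [AWB K A]
    [AddCommGroup B] [Module K B] [AWB K B] (f : AWBHom K A B) :
    d1 K B ∘ₗ C1Map f = f.toLinearMap ∘ₗ d1 K A := by
  ext a b
  · simpa [C1Map, d1] using (f.map_mul a b).symm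
  · simpa [C1Map, d1] using (f.map_br a b).symm

theorem d2_comp_C2Map {K A B : Type*} [Field K] [AddCommGroup A] [Module K A] [AWB K A]
    [AddCommGroup B] [Module K B] [AWB K B] (f : AWBHom K A B) :
    d2 K B ∘ₗ C2Map f = C1Map f ∘ₗ d2 K A := by
  have hm : ∀ a b : A, f.toLinearMap (mul (K := K) a b) = mul (K := K) (f.toLinearMap a) (f.toLinearMap b) :=
    f.map_mul
  have hb : ∀ a b : A, f.toLinearMap (br (K := K) a b) = br (K := K) (f.toLinearMap a) (f.toLinearMap b) :=
    f.map_br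
  ext a b c <;> simp [C2Map, C1Map, d2, hm, hb]

/-- The linear map `H₁(A) → H₁(B)` induced by a homomorphism `A → B`. -/
noncomputable def H1Map {K A B : Type*} [Field K] [AddCommGroup A] [Module K A] [AWB K A]
    [AddCommGroup B] [Module K B] [AWB K B] (f : AWBHom K A B) : H1 K A →ₗ[K] H1 K B :=
  Submodule.mapQ _ _
    ((C1Map f).restrict (p := LinearMap.ker (d1 K A)) (q := LinearMap.ker (d1 K B))
      (by
        intro x hx
        rw [LinearMap.mem_ker] at hx ⊢
        have := LinearMap.congr_fun (d1_comp_C1Map f) x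
        simpa [hx] using this))
    (by
      rintro x ⟨y, hy⟩
      refine ⟨C2Map f y, ?_⟩
      have := LinearMap.congr_fun (d2_comp_C2Map f) y
      simp only [LinearMap.comp_apply] at this
      rw [this, hy]
      rfl)

end AWB

/-! ### Free algebras with bracket -/

/-- Words in the elements of `X` under two binary operations. -/
inductive BracketWord (X : Type*) where
  | of : X → BracketWord X
  | mul : BracketWord X → BracketWord X → BracketWord X
  | br : BracketWord X → BracketWord X → BracketWord X

namespace AWB

/-- The bilinear extension to the vector space with basis `BracketWord X` of a binary operation on
words. -/
noncomputable def wordOp (K X : Type*) [Field K]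
    (op : BracketWord X → BracketWord X → BracketWord X) :
    (BracketWord X →₀ K) →ₗ[K] (BracketWord X →₀ K) →ₗ[K] (BracketWord X →₀ K) :=
  Finsupp.linearCombination K fun v =>
    Finsupp.linearCombination K fun w => Finsupp.single (op v w) (1 : K)

/-- `I` contains all `(ab)c - a(bc)` and `[ab, c] - ([a, c] b + a [b, c])`, and it is stable
under product and bracket with arbitrary elements on either side. -/
structure IsRelationIdeal (K X : Type*) [Field K] (I : Submodule K (BracketWord X →₀ K)) :
    Prop where
  assoc_mem : ∀ a b c, wordOp K X .mul (wordOp K X .mul a b) c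
    - wordOp K X .mul a (wordOp K X .mul b c) ∈ I
  br_mul_mem : ∀ a b c, wordOp K X .br (wordOp K X .mul a b) c
    - (wordOp K X .mul (wordOp K X .br a c) b + wordOp K X .mul a (wordOp K X .br b c)) ∈ I
  mul_left_mem : ∀ a x, x ∈ I → wordOp K X .mul a x ∈ I
  mul_right_mem : ∀ a x, x ∈ I → wordOp K X .mul x a ∈ I
  br_left_mem : ∀ a x, x ∈ I → wordOp K X .br a x ∈ I
  br_right_mem : ∀ a x, x ∈ I → wordOp K X .br x a ∈ I

/-- The smallest subspace with the property `IsRelationIdeal`. -/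
noncomputable def relations (K X : Type*) [Field K] : Submodule K (BracketWord X →₀ K) :=
  sInf {I | IsRelationIdeal K X I}

theorem isRelationIdeal_relations (K X : Type*) [Field K] :
    IsRelationIdeal K X (relations K X) where
  assoc_mem a b c := Submodule.mem_sInf.2 fun _ hI => hI.assoc_mem a b c
  br_mul_mem a b c := Submodule.mem_sInf.2 fun _ hI => hI.br_mul_mem a b c
  mul_left_mem a x hx := Submodule.mem_sInf.2 fun I hI =>
    hI.mul_left_mem a x (Submodule.mem_sInf.1 hx I hI)
  mul_right_mem a x hx := Submodule.mem_sInf.2 fun I hI =>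
    hI.mul_right_mem a x (Submodule.mem_sInf.1 hx I hI)
  br_left_mem a x hx := Submodule.mem_sInf.2 fun I hI =>
    hI.br_left_mem a x (Submodule.mem_sInf.1 hx I hI)
  br_right_mem a x hx := Submodule.mem_sInf.2 fun I hI =>
    hI.br_right_mem a x (Submodule.mem_sInf.1 hx I hI)

end AWB

/-- The free algebra with bracket on a set `X`. -/
abbrev FreeAWB (K X : Type*) [Field K] : Type _ := (BracketWord X →₀ K) ⧸ AWB.relations K X

namespace AWB

noncomputable instance free (K X : Type*) [Field K] : AWB K (FreeAWB K X) where
  mul := quotOp (wordOp K X .mul) _ (isRelationIdeal_relations K X).mul_left_mem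
    (isRelationIdeal_relations K X).mul_right_mem
  br := quotOp (wordOp K X .br) _ (isRelationIdeal_relations K X).br_left_mem
    (isRelationIdeal_relations K X).br_right_mem
  mul_assoc := by
    intro a b c
    induction a using Submodule.Quotient.induction_on with
    | _ a =>
      induction b using Submodule.Quotient.induction_on with
      | _ b =>
        induction c using Submodule.Quotient.induction_on with
        | _ c =>
          exact (Submodule.Quotient.eq _).2 ((isRelationIdeal_relations K X).assoc_mem a b c)
  br_mul := by
    intro a b c
    induction a using Submodule.Quotient.induction_on with
    | _ a =>
      induction b using Submodule.Quotient.induction_on with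
      | _ b =>
        induction c using Submodule.Quotient.induction_on with
        | _ c =>
          exact (Submodule.Quotient.eq _).2 ((isRelationIdeal_relations K X).br_mul_mem a b c)

/-- The generator of the free algebra with bracket given by `x`. -/
noncomputable def freeOf (K : Type*) {X : Type*} [Field K] (x : X) : FreeAWB K X :=
  Submodule.Quotient.mk (Finsupp.single (BracketWord.of x) (1 : K))

/-- `F` is a free algebra with bracket: for some subset `B` of `F`, the free algebra with bracket
on `B` is isomorphic to `F` by an isomorphism that is the identity on `B`. -/
def IsFree (K F : Type*) [Field K] [AddCommGroup F] [Module K F] [AWB K F] : Prop :=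
  ∃ (B : Set F) (e : AWBHom K (FreeAWB K B) F),
    (∀ b : B, e.toLinearMap (freeOf K b) = b) ∧ Function.Bijective e.toLinearMap

/-- A free presentation `0 → R → F → Q → 0` of `Q`. -/
structure FreePresentation.{u, v, w} (K : Type u) [Field K] (Q : Type v) [AddCommGroup Q]
    [Module K Q] [AWB K Q] where
  /-- the free algebra with bracket `F` -/
  F : Type w
  [addCommGroup : AddCommGroup F]
  [module : Module K F]
  [awb : AWB K F]
  isFree : IsFree K F
  /-- the projection `F → Q` -/
  rho : AWBHom K F Q
  surjective : Function.Surjective rho.toLinearMap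

attribute [instance] FreePresentation.addCommGroup FreePresentation.module FreePresentation.awb

namespace FreePresentation

/-- `R`, the kernel of `F → Q`. -/
def R {K Q : Type*} [Field K] [AddCommGroup Q] [Module K Q] [AWB K Q]
    (P : FreePresentation K Q) : Submodule K P.F :=
  LinearMap.ker P.rho.toLinearMap

/-- `S`, the inverse image of `Z(Q)` in `F`, so that `S / R = Z(Q)`. -/
def S {K Q : Type*} [Field K] [AddCommGroup Q] [Module K Q] [AWB K Q]
    (P : FreePresentation K Q) : Submodule K P.F :=
  (center K Q).toSubmodule.comap P.rho.toLinearMap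

/-- `R ∩ [[F, F]]`. -/
def RF {K Q : Type*} [Field K] [AddCommGroup Q] [Module K Q] [AWB K Q]
    (P : FreePresentation K Q) : Submodule K P.F :=
  P.R ⊓ derived K P.F

/-- `[[S, F]]`. -/
def SF {K Q : Type*} [Field K] [AddCommGroup Q] [Module K Q] [AWB K Q]
    (P : FreePresentation K Q) : Submodule K P.F :=
  commutator K P.S ⊤

/-- `[[S, F]] ⊆ R ∩ [[F, F]]`. -/
theorem SF_le_RF {K Q : Type*} [Field K] [AddCommGroup Q] [Module K Q] [AWB K Q]
    (P : FreePresentation K Q) : P.SF ≤ P.RF := by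
  refine le_inf ?_ (Submodule.span_mono ?_)
  · refine Submodule.span_le.2 ?_
    rintro x ⟨i, hi, j, -, h⟩
    obtain ⟨h1, h2, h3, h4⟩ := hi (P.rho.toLinearMap j)
    rcases h with rfl | rfl | rfl | rfl
    · exact (P.rho.map_mul i j).trans h1
    · exact (P.rho.map_mul j i).trans h2
    · exact (P.rho.map_br i j).trans h3
    · exact (P.rho.map_br j i).trans h4
  · rintro x ⟨i, -, j, hj, h⟩
    exact ⟨i, Submodule.mem_top, j, hj, h⟩

/-- The vector space `(R ∩ [[F, F]]) / [[S, F]]`. -/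
abbrev Term {K Q : Type*} [Field K] [AddCommGroup Q] [Module K Q] [AWB K Q]
    (P : FreePresentation K Q) : Type _ :=
  P.RF ⧸ P.SF.submoduleOf P.RF

/-- Let `f : Q → Q'` map `Z(Q)` into `Z(Q')`, and let `g : F → F'` be a lift of `f` to free
presentations. This is the map
`(R ∩ [[F, F]]) / [[S, F]] → (R' ∩ [[F', F']]) / [[S', F']]` induced by `g`. -/
def termMap {K Q Q₂ : Type*} [Field K] [AddCommGroup Q] [Module K Q] [AWB K Q]
    [AddCommGroup Q₂] [Module K Q₂] [AWB K Q₂] (P : FreePresentation K Q)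
    (P₂ : FreePresentation K Q₂) (f : AWBHom K Q Q₂)
    (hf : (center K Q).toSubmodule ≤ (center K Q₂).toSubmodule.comap f.toLinearMap)
    (g : AWBHom K P.F P₂.F)
    (hg : P₂.rho.toLinearMap ∘ₗ g.toLinearMap = f.toLinearMap ∘ₗ P.rho.toLinearMap) :
    P.Term →ₗ[K] P₂.Term :=
  Submodule.mapQ _ _
    (g.toLinearMap.restrict (p := P.RF) (q := P₂.RF)
      (by
        rintro x ⟨hx, hx2⟩
        refine ⟨?_, commutator_le_comap g le_top le_top hx2⟩
        have hx : P.rho.toLinearMap x = 0 := hx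
        have h := LinearMap.congr_fun hg x
        simp only [LinearMap.comp_apply, hx, map_zero] at h
        exact h))
    (by
      intro x hx
      refine commutator_le_comap (I₂ := P₂.S) (J₂ := ⊤) g ?_ le_top hx
      intro y hy
      have h := LinearMap.congr_fun hg y
      simp only [LinearMap.comp_apply] at h
      change P₂.rho.toLinearMap (g.toLinearMap y) ∈ (center K Q₂).toSubmodule
      rw [h]
      exact hf hy)

end FreePresentation

end AWB

universe u v w

/-! The sequence is a Hopf formula in disguise. Let `F → Q` be a free presentation and compose it
with `Q → Q/Z(Q)`; the composite has kernel `S`. A chain on `Q/Z(Q)` lifts to `u ∈ C₁(F)`. Its image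
is a cycle iff `d₁ u ∈ S`, and a boundary iff `d₁ u ∈ [[S, F]]`. Hence `d₁` identifies `H₁(Q/Z(Q))`
with `(S ∩ [[F, F]]) / [[S, F]]`. In these terms `θ` is induced by `F → Q`, so its kernel is `(R ∩
[[F, F]]) / [[S, F]]` and its image is `Z(Q) ∩ [[Q, Q]]`, the kernel of `π'`.

The boundary criterion rests on two facts. By right exactness of `⊗`, `d₁` maps the chains that die
in the quotient into `[[S, F]]` (`d1_mem_commutator_of_C1Map_eq_zero`). And `H₁(F) = 0` for free `F`
(`IsFree.ker_d1_le`), which is proved by giving `K^(X) ⊕ Coker d₂` a bracket structure and lifting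
`F` into it.

`θ` itself needs no presentation: product and bracket of `Q` vanish when one argument is central, so
`d₁` on `C₁(Q)` factors through `C₁(Q/Z(Q))`. Naturality follows because every map is computed on
arbitrary lifts of chains. -/

namespace AWBHom

variable {K A B C : Type*} [Field K] [AddCommGroup A] [Module K A] [AWB K A]
  [AddCommGroup B] [Module K B] [AWB K B] [AddCommGroup C] [Module K C] [AWB K C]

theorem toLinearMap_mul (f : AWBHom K A B) (a b : A) :
    f.toLinearMap (AWB.mul (K := K) a b)
      = AWB.mul (K := K) (f.toLinearMap a) (f.toLinearMap b) :=
  f.map_mul a b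

theorem toLinearMap_br (f : AWBHom K A B) (a b : A) :
    f.toLinearMap (AWB.br (K := K) a b)
      = AWB.br (K := K) (f.toLinearMap a) (f.toLinearMap b) :=
  f.map_br a b

/-- The composition of homomorphisms of algebras with bracket. -/
def comp (g : AWBHom K B C) (f : AWBHom K A B) : AWBHom K A C where
  toLinearMap := g.toLinearMap ∘ₗ f.toLinearMap
  map_mul a b := by
    change g.toLinearMap (f.toLinearMap _) = _
    rw [f.toLinearMap_mul, g.toLinearMap_mul]; rfl
  map_br a b := by
    change g.toLinearMap (f.toLinearMap _) = _
    rw [f.toLinearMap_br, g.toLinearMap_br]; rfl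

@[simp]
theorem comp_toLinearMap (g : AWBHom K B C) (f : AWBHom K A B) :
    (g.comp f).toLinearMap = g.toLinearMap ∘ₗ f.toLinearMap :=
  rfl

end AWBHom

namespace AWB

/-! ### Universal property of the free algebra with bracket -/

section FreeLift

variable {K X A : Type*} [Field K] [AddCommGroup A] [Module K A] [AWB K A]

/-- The value in `A` of a word in elements of `X` under an assignment `X → A`. -/
def evalWord (K : Type*) {X A : Type*} [Field K] [AddCommGroup A] [Module K A] [AWB K A]
    (φ : X → A) : BracketWord X → A
  | .of x => φ x
  | .mul v w => mul (K := K) (evalWord K φ v) (evalWord K φ w)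
  | .br v w => br (K := K) (evalWord K φ v) (evalWord K φ w)

theorem linearCombination_evalWord_mul (φ : X → A) (a b : BracketWord X →₀ K) :
    Finsupp.linearCombination K (evalWord K φ) (wordOp K X .mul a b)
      = mul (K := K) (Finsupp.linearCombination K (evalWord K φ) a)
          (Finsupp.linearCombination K (evalWord K φ) b) := by
  have h : (wordOp K X .mul).compr₂ (Finsupp.linearCombination K (evalWord K φ))
      = (mul (K := K)).compl₁₂ (Finsupp.linearCombination K (evalWord K φ))
          (Finsupp.linearCombination K (evalWord K φ)) := by
    ext v w
    simp [wordOp, evalWord]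
  exact LinearMap.congr_fun₂ h a b

theorem linearCombination_evalWord_br (φ : X → A) (a b : BracketWord X →₀ K) :
    Finsupp.linearCombination K (evalWord K φ) (wordOp K X .br a b)
      = br (K := K) (Finsupp.linearCombination K (evalWord K φ) a)
          (Finsupp.linearCombination K (evalWord K φ) b) := by
  have h : (wordOp K X .br).compr₂ (Finsupp.linearCombination K (evalWord K φ))
      = (br (K := K)).compl₁₂ (Finsupp.linearCombination K (evalWord K φ))
          (Finsupp.linearCombination K (evalWord K φ)) := by
    ext v w
    simp [wordOp, evalWord]
  exact LinearMap.congr_fun₂ h a b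

/-- Since `relations` is the smallest relation ideal, this makes evaluation of words descend to
`FreeAWB`. -/
theorem isRelationIdeal_ker_evalWord (φ : X → A) :
    IsRelationIdeal K X (LinearMap.ker (Finsupp.linearCombination K (evalWord K φ))) where
  assoc_mem a b c := by
    simp [linearCombination_evalWord_mul, mul_assoc]
  br_mul_mem a b c := by
    simp [linearCombination_evalWord_mul, linearCombination_evalWord_br, br_mul]
  mul_left_mem a x hx := by
    rw [LinearMap.mem_ker] at hx ⊢
    simp [linearCombination_evalWord_mul, hx]
  mul_right_mem a x hx := by
    rw [LinearMap.mem_ker] at hx ⊢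
    simp [linearCombination_evalWord_mul, hx]
  br_left_mem a x hx := by
    rw [LinearMap.mem_ker] at hx ⊢
    simp [linearCombination_evalWord_br, hx]
  br_right_mem a x hx := by
    rw [LinearMap.mem_ker] at hx ⊢
    simp [linearCombination_evalWord_br, hx]

/-- The homomorphism from the free algebra with bracket on `X` that extends a map `X → A`. -/
noncomputable def freeLift (φ : X → A) : AWBHom K (FreeAWB K X) A where
  toLinearMap := (relations K X).liftQ (Finsupp.linearCombination K (evalWord K φ))
    (sInf_le (isRelationIdeal_ker_evalWord φ))
  map_mul a b := by
    induction a using Submodule.Quotient.induction_on with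
    | _ a =>
      induction b using Submodule.Quotient.induction_on with
      | _ b => exact linearCombination_evalWord_mul φ a b
  map_br a b := by
    induction a using Submodule.Quotient.induction_on with
    | _ a =>
      induction b using Submodule.Quotient.induction_on with
      | _ b => exact linearCombination_evalWord_br φ a b

theorem freeLift_freeOf (φ : X → A) (x : X) :
    (freeLift (K := K) φ).toLinearMap (freeOf K x) = φ x := by
  change Finsupp.linearCombination K (evalWord K φ) (Finsupp.single (BracketWord.of x) 1) = φ x
  simp [evalWord]

/-- Homomorphisms from a free algebra with bracket are determined by their values on the
generators. -/
theorem freeHom_ext {f g : AWBHom K (FreeAWB K X) A}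
    (h : ∀ x : X, f.toLinearMap (freeOf K x) = g.toLinearMap (freeOf K x)) :
    f.toLinearMap = g.toLinearMap := by
  -- Words span the free algebra, so it suffices to compare the values on words, by induction on the
  -- word.
  refine Submodule.linearMap_qext _ (Finsupp.lhom_ext' fun w => LinearMap.ext_ring ?_)
  change f.toLinearMap (Submodule.Quotient.mk (Finsupp.single w 1))
    = g.toLinearMap (Submodule.Quotient.mk (Finsupp.single w 1))
  induction w with
  | of x => exact h x
  | mul v w hv hw =>
    have e : (Submodule.Quotient.mk (Finsupp.single (BracketWord.mul v w) 1) : FreeAWB K X)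
        = mul (K := K) (Submodule.Quotient.mk (Finsupp.single v 1) : FreeAWB K X)
            (Submodule.Quotient.mk (Finsupp.single w 1)) := by
      change _ = Submodule.Quotient.mk (wordOp K X .mul _ _)
      simp [wordOp]
    rw [e, f.toLinearMap_mul, g.toLinearMap_mul, hv, hw]
  | br v w hv hw =>
    have e : (Submodule.Quotient.mk (Finsupp.single (BracketWord.br v w) 1) : FreeAWB K X)
        = br (K := K) (Submodule.Quotient.mk (Finsupp.single v 1) : FreeAWB K X)
            (Submodule.Quotient.mk (Finsupp.single w 1)) := by
      change _ = Submodule.Quotient.mk (wordOp K X .br _ _)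
      simp [wordOp]
    rw [e, f.toLinearMap_br, g.toLinearMap_br, hv, hw]

end FreeLift

/-! ### The cokernel of `d₂` -/

section Coker

variable (K : Type*) (A : Type*) [Field K] [AddCommGroup A] [Module K A] [AWB K A]

/-- The cokernel of `d₂ : C₂(A) → C₁(A)`. -/
abbrev CokerD2 : Type _ := C1 K A ⧸ LinearMap.range (d2 K A)

/-- The map `Coker d₂ → A` induced by `d₁`. -/
noncomputable def cokerD1 : CokerD2 K A →ₗ[K] A :=
  (LinearMap.range (d2 K A)).liftQ (d1 K A)
    (LinearMap.range_le_ker_iff.2 (d1_comp_d2 K A))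

/-- The class of `a ⊗ b` in `Coker d₂`, as a bilinear map. -/
noncomputable def cokerTensor : A →ₗ[K] A →ₗ[K] CokerD2 K A :=
  (TensorProduct.mk K A A).compr₂
    ((LinearMap.range (d2 K A)).mkQ ∘ₗ LinearMap.inl K (A ⊗[K] A) (A ⊗[K] A))

/-- The class of `a ∘ b` in `Coker d₂`, as a bilinear map. -/
noncomputable def cokerCirc : A →ₗ[K] A →ₗ[K] CokerD2 K A :=
  (TensorProduct.mk K A A).compr₂
    ((LinearMap.range (d2 K A)).mkQ ∘ₗ LinearMap.inr K (A ⊗[K] A) (A ⊗[K] A))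

variable {K A}

@[simp]
theorem cokerD1_cokerTensor (a b : A) :
    cokerD1 K A (cokerTensor K A a b) = mul (K := K) a b := by
  change d1 K A (a ⊗ₜ[K] b, 0) = _
  simp [d1]

@[simp]
theorem cokerD1_cokerCirc (a b : A) :
    cokerD1 K A (cokerCirc K A a b) = br (K := K) a b := by
  change d1 K A (0, a ⊗ₜ[K] b) = _
  simp [d1]

/-- The two relations imposed by `d₂` are exactly what associativity and the bracket identity
require of `TensorExt`: this one gives the former, `cokerCirc_mul` the latter. -/
theorem cokerTensor_mul (a b c : A) :
    cokerTensor K A (mul (K := K) a b) c = cokerTensor K A a (mul (K := K) b c) := by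
  refine (Submodule.Quotient.eq _).2 ⟨((a ⊗ₜ[K] b) ⊗ₜ[K] c, 0), ?_⟩
  simp [d2]

theorem cokerCirc_mul (a b c : A) :
    cokerCirc K A (mul (K := K) a b) c
      = cokerTensor K A (br (K := K) a c) b + cokerTensor K A a (br (K := K) b c) := by
  symm
  refine (Submodule.Quotient.eq _).2 ⟨(0, (a ⊗ₜ[K] b) ⊗ₜ[K] c), ?_⟩
  simp [d2]

theorem cokerD2_hom_ext {M : Type*} [AddCommGroup M] [Module K M] {f g : CokerD2 K A →ₗ[K] M}
    (ht : ∀ a b, f (cokerTensor K A a b) = g (cokerTensor K A a b))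
    (hc : ∀ a b, f (cokerCirc K A a b) = g (cokerCirc K A a b)) : f = g := by
  refine Submodule.linearMap_qext _ (LinearMap.prod_ext ?_ ?_)
  · exact TensorProduct.ext' ht
  · exact TensorProduct.ext' hc

end Coker

/-! ### Vanishing of `H₁` for free algebras -/

section VanishingHomology

/-- For a map `φ : X → A`, the vector space `K^(X) ⊕ Coker d₂`. It carries the structure of an
algebra with bracket for which `(x, c) ↦ φ x + d₁ c` is a homomorphism to `A`. -/
def TensorExt (K : Type*) {X A : Type*} [Field K] [AddCommGroup A] [Module K A] [AWB K A]
    (_φ : X → A) : Type _ :=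
  (X →₀ K) × CokerD2 K A

namespace TensorExt

variable {K X A : Type*} [Field K] [AddCommGroup A] [Module K A] [AWB K A] (φ : X → A)

noncomputable instance : AddCommGroup (TensorExt K φ) :=
  inferInstanceAs (AddCommGroup ((X →₀ K) × CokerD2 K A))

noncomputable instance : Module K (TensorExt K φ) :=
  inferInstanceAs (Module K ((X →₀ K) × CokerD2 K A))

/-- The inclusion of the summand `Coker d₂`. -/
noncomputable def incl : CokerD2 K A →ₗ[K] TensorExt K φ :=
  LinearMap.inr K (X →₀ K) (CokerD2 K A)

/-- The inclusion of the summand `K^(X)`. -/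
noncomputable def gen : (X →₀ K) →ₗ[K] TensorExt K φ :=
  LinearMap.inl K (X →₀ K) (CokerD2 K A)

/-- The linear map `(x, c) ↦ φ x + d₁ c`. -/
noncomputable def toBase : TensorExt K φ →ₗ[K] A :=
  LinearMap.coprod (Finsupp.linearCombination K φ) (cokerD1 K A)

@[simp]
theorem toBase_incl (c : CokerD2 K A) : toBase φ (incl φ c) = cokerD1 K A c := by
  change Finsupp.linearCombination K φ 0 + cokerD1 K A c = _
  rw [map_zero, zero_add]

@[simp]
theorem toBase_gen (x : X →₀ K) :
    toBase φ (gen φ x) = Finsupp.linearCombination K φ x := by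
  change Finsupp.linearCombination K φ x + cokerD1 K A 0 = _
  rw [map_zero, add_zero]

/-- Operations see their arguments only through `toBase` and take values in `Coker d₂`, where
`cokerD1` turns a class back into the actual product or bracket. The summand `K^(X)` only supplies
preimages of the elements `φ x`. -/
noncomputable instance : AWB K (TensorExt K φ) where
  mul := ((cokerTensor K A).compl₁₂ (toBase φ) (toBase φ)).compr₂ (incl φ)
  br := ((cokerCirc K A).compl₁₂ (toBase φ) (toBase φ)).compr₂ (incl φ)
  mul_assoc a b c := by simp [cokerTensor_mul]
  br_mul a b c := by simp [cokerCirc_mul]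

theorem mul_def (a b : TensorExt K φ) :
    mul (K := K) a b = incl φ (cokerTensor K A (toBase φ a) (toBase φ b)) :=
  rfl

theorem br_def (a b : TensorExt K φ) :
    br (K := K) a b = incl φ (cokerCirc K A (toBase φ a) (toBase φ b)) :=
  rfl

/-- The homomorphism `(x, c) ↦ φ x + d₁ c`. -/
noncomputable def toBaseHom : AWBHom K (TensorExt K φ) A where
  toLinearMap := toBase φ
  map_mul a b := by
    change toBase φ _ = mul (K := K) (toBase φ a) (toBase φ b)
    simp [mul_def]
  map_br a b := by
    change toBase φ _ = br (K := K) (toBase φ a) (toBase φ b)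
    simp [br_def]

end TensorExt

variable {K F : Type*} [Field K] [AddCommGroup F] [Module K F] [AWB K F]

/-- For a free algebra with bracket the map `Coker d₂ → F` induced by `d₁` is injective. -/
theorem IsFree.cokerD1_injective (hF : IsFree K F) : Function.Injective (cokerD1 K F) := by
  obtain ⟨B, e, he, hbij⟩ := hF
  let φ : B → F := Subtype.val
  let s := freeLift (K := K) (fun b : B => TensorExt.gen (K := K) φ (Finsupp.single b 1))
  -- Both sides are homomorphisms on the free algebra and agree on generators.
  have hs : TensorExt.toBase φ ∘ₗ s.toLinearMap = e.toLinearMap := by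
    refine freeHom_ext (f := (TensorExt.toBaseHom φ).comp s) (g := e) fun b => ?_
    change TensorExt.toBase φ (s.toLinearMap _) = _
    rw [freeLift_freeOf, he]
    simp [φ]
  have hs' : ∀ a, TensorExt.toBase φ (s.toLinearMap a) = e.toLinearMap a :=
    LinearMap.congr_fun hs
  let t : F →ₗ[K] TensorExt K φ :=
    s.toLinearMap ∘ₗ (LinearEquiv.ofBijective e.toLinearMap hbij).symm.toLinearMap
  have ht : ∀ a, t (e.toLinearMap a) = s.toLinearMap a := fun a =>
    congrArg s.toLinearMap ((LinearEquiv.ofBijective e.toLinearMap hbij).symm_apply_apply a)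
  -- `t` is a multiplicative and bracket-preserving section of `toBase`, so it sends `ab` to the
  -- class of `a ⊗ b` and `[a, b]` to that of `a ∘ b`. Thus `t` recovers a class from its image
  -- under `d₁`.
  have key : t ∘ₗ cokerD1 K F = TensorExt.incl φ := by
    refine cokerD2_hom_ext (fun a b => ?_) (fun a b => ?_) <;>
      obtain ⟨a, rfl⟩ := hbij.2 a <;> obtain ⟨b, rfl⟩ := hbij.2 b
    · rw [LinearMap.comp_apply, cokerD1_cokerTensor, ← e.toLinearMap_mul, ht,
        s.toLinearMap_mul, TensorExt.mul_def, hs', hs']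
    · rw [LinearMap.comp_apply, cokerD1_cokerCirc, ← e.toLinearMap_br, ht,
        s.toLinearMap_br, TensorExt.br_def, hs', hs']
  have hinj : Function.Injective (t ∘ₗ cokerD1 K F) := by
    rw [key]
    exact LinearMap.inr_injective
  exact Function.Injective.of_comp (f := t) hinj

/-- The first homology of a free algebra with bracket vanishes. -/
theorem IsFree.ker_d1_le (hF : IsFree K F) :
    LinearMap.ker (d1 K F) ≤ LinearMap.range (d2 K F) := by
  intro u hu
  refine (Submodule.Quotient.mk_eq_zero _).1 (hF.cokerD1_injective ?_)
  rw [map_zero]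
  exact hu

end VanishingHomology

/-! ### Induced maps on chains and lifting along surjections -/

section Functoriality

variable {K A B C D : Type*} [Field K] [AddCommGroup A] [Module K A] [AWB K A]
  [AddCommGroup B] [Module K B] [AWB K B] [AddCommGroup C] [Module K C] [AWB K C]
  [AddCommGroup D] [Module K D] [AWB K D]

/-- Allows every element of `[[A, A]]` to be written as `d₁` of a chain, which can then be lifted or
pushed forward. -/
theorem range_d1 (K A : Type*) [Field K] [AddCommGroup A] [Module K A] [AWB K A] :
    LinearMap.range (d1 K A) = derived K A := by
  apply le_antisymm
  · rw [d1, LinearMap.range_coprod, sup_le_iff]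
    constructor <;> rintro _ ⟨u, rfl⟩ <;> induction u using TensorProduct.induction_on with
    | zero => rw [map_zero]; exact zero_mem _
    | add u v hu hv => rw [map_add]; exact add_mem hu hv
    | tmul a b => exact Submodule.subset_span ⟨a, trivial, b, trivial, by simp⟩
  · refine Submodule.span_le.2 ?_
    rintro x ⟨i, -, j, -, rfl | rfl | rfl | rfl⟩
    · exact ⟨(i ⊗ₜ j, 0), by simp [d1]⟩
    · exact ⟨(j ⊗ₜ i, 0), by simp [d1]⟩
    · exact ⟨(0, i ⊗ₜ j), by simp [d1]⟩
    · exact ⟨(0, j ⊗ₜ i), by simp [d1]⟩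

theorem d1_C1Map (f : AWBHom K A B) (u : C1 K A) :
    d1 K B (C1Map f u) = f.toLinearMap (d1 K A u) :=
  LinearMap.congr_fun (d1_comp_C1Map f) u

theorem d2_C2Map (f : AWBHom K A B) (u : C2 K A) :
    d2 K B (C2Map f u) = C1Map f (d2 K A u) :=
  LinearMap.congr_fun (d2_comp_C2Map f) u

theorem d1_d2 (u : C2 K A) : d1 K A (d2 K A u) = 0 :=
  LinearMap.congr_fun (d1_comp_d2 K A) u

theorem C1Map_comp (g : AWBHom K B C) (f : AWBHom K A B) :
    C1Map (g.comp f) = C1Map g ∘ₗ C1Map f := by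
  ext <;> simp [C1Map]

theorem C1Map_comm {f : AWBHom K A B} {g : AWBHom K B D} {f' : AWBHom K A C} {g' : AWBHom K C D}
    (h : g.toLinearMap ∘ₗ f.toLinearMap = g'.toLinearMap ∘ₗ f'.toLinearMap) (u : C1 K A) :
    C1Map g (C1Map f u) = C1Map g' (C1Map f' u) := by
  rw [← LinearMap.comp_apply, ← LinearMap.comp_apply, ← C1Map_comp, ← C1Map_comp]
  simp only [C1Map, AWBHom.comp_toLinearMap, h]

theorem C1Map_surjective {f : AWBHom K A B} (hf : Function.Surjective f.toLinearMap) :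
    Function.Surjective (C1Map f) :=
  Function.Surjective.prodMap (TensorProduct.map_surjective hf hf)
    (TensorProduct.map_surjective hf hf)

theorem C2Map_surjective {f : AWBHom K A B} (hf : Function.Surjective f.toLinearMap) :
    Function.Surjective (C2Map f) :=
  Function.Surjective.prodMap
    (TensorProduct.map_surjective (TensorProduct.map_surjective hf hf) hf)
    (TensorProduct.map_surjective (TensorProduct.map_surjective hf hf) hf)

/-- A bilinear map with values in `W` whenever one argument is in `Ker p` maps `Ker (p ⊗ p)` into
`W`. -/
theorem ker_tensorMap_le {M N P : Type*} [AddCommGroup M] [Module K M] [AddCommGroup N]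
    [Module K N] [AddCommGroup P] [Module K P] {p : M →ₗ[K] N} (hp : Function.Surjective p)
    (m : M →ₗ[K] M →ₗ[K] P) (W : Submodule K P) (hl : ∀ i ∈ LinearMap.ker p, ∀ a, m i a ∈ W)
    (hr : ∀ i ∈ LinearMap.ker p, ∀ a, m a i ∈ W) :
    LinearMap.ker (TensorProduct.map p p) ≤ W.comap (TensorProduct.lift m) := by
  -- Right exactness: the kernel of `p ⊗ p` is generated by the images of `Ker p ⊗ M` and `M ⊗ Ker
  -- p`.
  rw [TensorProduct.map_ker (f := (LinearMap.ker p).subtype) (f' := (LinearMap.ker p).subtype)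
    (p.exact_subtype_ker_map) hp (p.exact_subtype_ker_map) hp, sup_le_iff]
  constructor <;> rintro _ ⟨u, rfl⟩ <;> induction u using TensorProduct.induction_on with
  | zero => rw [map_zero]; exact zero_mem _
  | add u v hu hv => rw [map_add]; exact add_mem hu hv
  | tmul a b => first | simpa using hl _ a.2 b | simpa using hr _ b.2 a

/-- If `p : A → B` is surjective, then `d₁` maps the kernel of `C₁(A) → C₁(B)` into
`[[Ker p, A]]`. -/
theorem d1_mem_commutator_of_C1Map_eq_zero {p : AWBHom K A B}
    (hp : Function.Surjective p.toLinearMap) {u : C1 K A} (hu : C1Map p u = 0) :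
    d1 K A u ∈ commutator K (LinearMap.ker p.toLinearMap) ⊤ := by
  obtain ⟨u, v⟩ := u
  have hu' : TensorProduct.map p.toLinearMap p.toLinearMap u = 0 := congrArg Prod.fst hu
  have hv' : TensorProduct.map p.toLinearMap p.toLinearMap v = 0 := congrArg Prod.snd hu
  have h1 := ker_tensorMap_le hp (mul (K := K))
    (commutator K (LinearMap.ker p.toLinearMap) ⊤)
    (fun i hi a => Submodule.subset_span ⟨i, hi, a, trivial, by simp⟩)
    (fun i hi a => Submodule.subset_span ⟨i, hi, a, trivial, by simp⟩) hu'
  have h2 := ker_tensorMap_le hp (br (K := K))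
    (commutator K (LinearMap.ker p.toLinearMap) ⊤)
    (fun i hi a => Submodule.subset_span ⟨i, hi, a, trivial, by simp⟩)
    (fun i hi a => Submodule.subset_span ⟨i, hi, a, trivial, by simp⟩) hv'
  exact add_mem h1 h2

/-- The class in `H₁(A)` of a cycle. -/
noncomputable def H1mk (u : C1 K A) (hu : d1 K A u = 0) : H1 K A :=
  Submodule.Quotient.mk ⟨u, hu⟩

theorem H1mk_eq_iff {u v : C1 K A} {hu : d1 K A u = 0} {hv : d1 K A v = 0} :
    H1mk u hu = H1mk v hv ↔ u - v ∈ LinearMap.range (d2 K A) :=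
  Submodule.Quotient.eq _

theorem H1mk_eq_zero_iff {u : C1 K A} {hu : d1 K A u = 0} :
    H1mk u hu = 0 ↔ u ∈ LinearMap.range (d2 K A) :=
  Submodule.Quotient.mk_eq_zero _

theorem exists_H1mk (x : H1 K A) : ∃ u hu, x = H1mk u hu := by
  obtain ⟨⟨u, hu⟩, rfl⟩ := Submodule.Quotient.mk_surjective _ x
  exact ⟨u, hu, rfl⟩

theorem H1Map_H1mk (f : AWBHom K A B) (u : C1 K A) (hu : d1 K A u = 0) :
    H1Map f (H1mk u hu) = H1mk (C1Map f u) (by rw [d1_C1Map, hu, map_zero]) :=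
  rfl

end Functoriality

/-! ### The map `θ` and exactness at `[[Q, Q]]` -/

section Theta

variable {K : Type*} (Q : Type*) [Field K] [AddCommGroup Q] [Module K Q] [AWB K Q]

theorem proj_surjective (I : AWBIdeal K Q) : Function.Surjective (proj I).toLinearMap :=
  Submodule.mkQ_surjective _

theorem ker_proj (I : AWBIdeal K Q) : LinearMap.ker (proj I).toLinearMap = I.toSubmodule :=
  Submodule.ker_mkQ _

theorem proj_eq_zero_iff (I : AWBIdeal K Q) (x : Q) :
    (proj I).toLinearMap x = 0 ↔ x ∈ I.toSubmodule :=
  Submodule.Quotient.mk_eq_zero _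

theorem commutator_center : commutator K (center K Q).toSubmodule ⊤ = ⊥ := by
  refine le_bot_iff.1 (Submodule.span_le.2 ?_)
  rintro x ⟨i, hi, j, -, h⟩
  obtain ⟨h1, h2, h3, h4⟩ := hi j
  rcases h with rfl | rfl | rfl | rfl
  · exact h1
  · exact h2
  · exact h3
  · exact h4

/-- The map `C₁(Q / Z(Q)) → [[Q, Q]]` that sends the classes of `a ⊗ b` and `a ∘ b` to `ab` and
`[a, b]`. -/
noncomputable def d1OfCenter :
    C1 K (Q ⧸ (center K Q).toSubmodule) →ₗ[K] derived K Q :=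
  (LinearMap.ker (C1Map (proj (center K Q)))).liftQ
      ((d1 K Q).codRestrict (derived K Q) fun u => range_d1 K Q ▸ ⟨u, rfl⟩)
      (by
        intro u hu
        -- A chain that dies in `C₁(Q/Z(Q))` has `d₁` in `[[Z(Q), Q]] = 0`.
        have h := d1_mem_commutator_of_C1Map_eq_zero (proj_surjective Q _) hu
        rw [ker_proj, commutator_center] at h
        exact Subtype.ext h) ∘ₗ
    ((C1Map (proj (center K Q))).quotKerEquivOfSurjective
      (C1Map_surjective (proj_surjective Q _))).symm.toLinearMap

theorem d1OfCenter_C1Map (u : C1 K Q) :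
    (d1OfCenter Q (C1Map (proj (center K Q)) u) : Q) = d1 K Q u := by
  have h : ((C1Map (proj (center K Q))).quotKerEquivOfSurjective
      (C1Map_surjective (proj_surjective Q _))).symm (C1Map (proj (center K Q)) u)
      = Submodule.Quotient.mk u := by
    rw [LinearEquiv.symm_apply_eq]
    rfl
  rw [d1OfCenter, LinearMap.comp_apply, LinearEquiv.coe_coe, h]
  rfl

/-- The map `θ : H₁(Q / Z(Q)) → [[Q, Q]]`. -/
noncomputable def theta : H1 K (Q ⧸ (center K Q).toSubmodule) →ₗ[K] derived K Q :=
  Submodule.liftQ _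
    (d1OfCenter Q ∘ₗ (LinearMap.ker (d1 K (Q ⧸ (center K Q).toSubmodule))).subtype)
    (by
      rintro ⟨x, hx⟩ ⟨y, hy⟩
      -- A boundary over `Q/Z(Q)` lifts to a boundary over `Q`, on which `d₁` vanishes.
      obtain ⟨w, rfl⟩ := C2Map_surjective (proj_surjective Q (center K Q)) y
      have hy : d2 K _ (C2Map (proj (center K Q)) w) = x := hy
      refine Subtype.ext ?_
      change (d1OfCenter Q x : Q) = 0
      rw [← hy, d2_C2Map, d1OfCenter_C1Map, d1_d2])

/-- The working formula for `θ`: the lift `u` is arbitrary and need not be a cycle over `Q`. -/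
theorem theta_H1mk (u : C1 K Q) (hu : d1 K _ (C1Map (proj (center K Q)) u) = 0) :
    (theta Q (H1mk _ hu) : Q) = d1 K Q u :=
  d1OfCenter_C1Map Q u

theorem exists_H1mk_proj (x : H1 K (Q ⧸ (center K Q).toSubmodule)) :
    ∃ (u : C1 K Q) (hu : d1 K _ (C1Map (proj (center K Q)) u) = 0), x = H1mk _ hu := by
  obtain ⟨v, hv, rfl⟩ := exists_H1mk x
  obtain ⟨u, rfl⟩ := C1Map_surjective (proj_surjective Q (center K Q)) v
  exact ⟨u, hv, rfl⟩

/-- An element of `[[Q, Q]]` is some `d₁ u`, and it is central iff the image of `u` over `Q/Z(Q)` is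
a cycle; its class is then the required preimage. -/
theorem theta_exact :
    Function.Exact (theta (K := K) Q) (derivedMap (proj (center K Q))) := by
  rintro ⟨x, hx⟩
  constructor
  · intro h
    have h0 : (proj (center K Q)).toLinearMap x = 0 := congrArg Subtype.val h
    obtain ⟨u, rfl⟩ := (range_d1 K Q).symm ▸ hx
    have hu : d1 K _ (C1Map (proj (center K Q)) u) = 0 := by rw [d1_C1Map, h0]
    exact ⟨H1mk _ hu, Subtype.ext (theta_H1mk Q u hu)⟩
  · rintro ⟨y, hy⟩
    obtain ⟨u, hu, rfl⟩ := exists_H1mk_proj Q y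
    refine Subtype.ext ?_
    change (proj (center K Q)).toLinearMap x = 0
    have hx' : d1 K Q u = x := by rw [← theta_H1mk Q u hu, hy]
    rw [← hx', ← d1_C1Map, hu]

end Theta

theorem derivedMap_surjective {K A B : Type*} [Field K] [AddCommGroup A] [Module K A] [AWB K A]
    [AddCommGroup B] [Module K B] [AWB K B] {f : AWBHom K A B}
    (hf : Function.Surjective f.toLinearMap) : Function.Surjective (derivedMap f) := by
  rintro ⟨x, hx⟩
  obtain ⟨v, rfl⟩ := (range_d1 K B).symm ▸ hx
  obtain ⟨u, rfl⟩ := C1Map_surjective hf v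
  exact ⟨⟨d1 K A u, range_d1 K A ▸ ⟨u, rfl⟩⟩, Subtype.ext (d1_C1Map f u).symm⟩

/-! ### The map `ι` from a free presentation and exactness at `H₁` -/

namespace FreePresentation

variable {K Q : Type*} [Field K] [AddCommGroup Q] [Module K Q] [AWB K Q]
  (P : FreePresentation K Q)

/-- The composition `F → Q → Q / Z(Q)`, whose kernel is `S`. -/
def toQuot : AWBHom K P.F (Q ⧸ (center K Q).toSubmodule) :=
  (proj (center K Q)).comp P.rho

theorem toQuot_surjective : Function.Surjective P.toQuot.toLinearMap :=
  (proj_surjective Q _).comp P.surjective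

theorem ker_toQuot : LinearMap.ker P.toQuot.toLinearMap = P.S := by
  ext x
  exact proj_eq_zero_iff Q _ _

theorem RF_le_range_d1 : P.RF ≤ LinearMap.range (d1 K P.F) := by
  rw [range_d1]
  exact inf_le_right

/-- An arbitrary linear choice, available over a field. It makes `iota` linear by construction;
`iota_termMk` shows that the choice does not matter. -/
theorem exists_d1_section : ∃ σ : P.RF →ₗ[K] C1 K P.F, ∀ x, d1 K P.F (σ x) = x := by
  obtain ⟨σ, hσ⟩ := (d1 K P.F).rangeRestrict.exists_rightInverse_of_surjective
    (d1 K P.F).range_rangeRestrict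
  exact ⟨σ ∘ₗ Submodule.inclusion P.RF_le_range_d1,
    fun x => congrArg Subtype.val (LinearMap.congr_fun hσ _)⟩

/-- A linear section of `d₁ : C₁(F) → F` over `R ∩ [[F, F]]`. -/
noncomputable def d1Section : P.RF →ₗ[K] C1 K P.F :=
  P.exists_d1_section.choose

theorem d1_d1Section (x : P.RF) : d1 K P.F (P.d1Section x) = x :=
  P.exists_d1_section.choose_spec x

/-- The class in `(R ∩ [[F, F]]) / [[S, F]]` of an element of `R ∩ [[F, F]]`. -/
def termMk (x : P.F) (hx : x ∈ P.RF) : P.Term :=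
  Submodule.Quotient.mk ⟨x, hx⟩

theorem termMk_eq_zero_iff {x : P.F} {hx : x ∈ P.RF} : P.termMk x hx = 0 ↔ x ∈ P.SF :=
  Submodule.Quotient.mk_eq_zero _

theorem exists_termMk (x : P.Term) :
    ∃ (u : C1 K P.F) (hu : d1 K P.F u ∈ P.RF), x = P.termMk _ hu := by
  obtain ⟨⟨y, hy⟩, rfl⟩ := Submodule.Quotient.mk_surjective _ x
  obtain ⟨v, rfl⟩ := (range_d1 K P.F).symm ▸ hy.2
  exact ⟨v, hy, rfl⟩

theorem d1_C1Map_toQuot {u : C1 K P.F} (hu : d1 K P.F u ∈ P.RF) :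
    d1 K _ (C1Map P.toQuot u) = 0 := by
  have h : P.rho.toLinearMap (d1 K P.F u) = 0 := hu.1
  rw [d1_C1Map]
  change (proj (center K Q)).toLinearMap (P.rho.toLinearMap _) = 0
  rw [h, map_zero]

/-- The only place where freeness enters. A generator of `[[S, F]]` is `d₁` of a chain with a factor
in `S`, which dies in the quotient. So `u` differs from a dying chain by a cycle on `F`, which is a
boundary because `H₁(F) = 0`. -/
theorem C1Map_toQuot_mem_range_d2_of_d1_mem {u : C1 K P.F} (hu : d1 K P.F u ∈ P.SF) :
    C1Map P.toQuot u ∈ LinearMap.range (d2 K (Q ⧸ (center K Q).toSubmodule)) := by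
  have hS : ∀ i ∈ P.S, P.toQuot.toLinearMap i = 0 := fun i hi => by
    rwa [← ker_toQuot] at hi
  have hle : P.SF ≤ (LinearMap.ker (C1Map P.toQuot)).map (d1 K P.F) := by
    refine Submodule.span_le.2 ?_
    rintro x ⟨i, hi, j, -, rfl | rfl | rfl | rfl⟩
    · exact ⟨(i ⊗ₜ j, 0), by simp [C1Map, hS i hi], by simp [d1]⟩
    · exact ⟨(j ⊗ₜ i, 0), by simp [C1Map, hS i hi], by simp [d1]⟩
    · exact ⟨(0, i ⊗ₜ j), by simp [C1Map, hS i hi], by simp [d1]⟩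
    · exact ⟨(0, j ⊗ₜ i), by simp [C1Map, hS i hi], by simp [d1]⟩
  obtain ⟨v, hv, hvu⟩ := hle hu
  obtain ⟨w, hw⟩ := P.isFree.ker_d1_le (x := u - v) (by
    rw [LinearMap.mem_ker, map_sub, hvu, sub_self])
  refine ⟨C2Map P.toQuot w, ?_⟩
  have hv0 : C1Map P.toQuot v = 0 := hv
  rw [d2_C2Map, hw, map_sub, hv0, sub_zero]

/-- Lifting the boundary to `C₂(F)` and subtracting it leaves `d₁ u` unchanged and makes the image
of `u` zero. This yields injectivity of `iota`. -/
theorem d1_mem_of_C1Map_toQuot_mem_range_d2 {u : C1 K P.F}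
    (hu : C1Map P.toQuot u ∈ LinearMap.range (d2 K (Q ⧸ (center K Q).toSubmodule))) :
    d1 K P.F u ∈ P.SF := by
  obtain ⟨y, hy⟩ := hu
  obtain ⟨w, rfl⟩ := C2Map_surjective P.toQuot_surjective y
  have h := d1_mem_commutator_of_C1Map_eq_zero P.toQuot_surjective (u := u - d2 K P.F w) (by
    rw [map_sub, ← hy, d2_C2Map, sub_self])
  rwa [map_sub, d1_d2, sub_zero, ker_toQuot] at h

/-- The map `(R ∩ [[F, F]]) / [[S, F]] → H₁(Q / Z(Q))`: it sends the class of `d₁ u` for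
`u ∈ C₁(F)` to the class of the image of `u` in `C₁(Q / Z(Q))`. -/
noncomputable def iota : P.Term →ₗ[K] H1 K (Q ⧸ (center K Q).toSubmodule) :=
  Submodule.mapQ _ _
    ((C1Map P.toQuot ∘ₗ P.d1Section).codRestrict
      (LinearMap.ker (d1 K (Q ⧸ (center K Q).toSubmodule)))
      (fun x => P.d1_C1Map_toQuot (by
        rw [d1_d1Section]
        exact x.2)))
    (fun x hx => P.C1Map_toQuot_mem_range_d2_of_d1_mem (by
      rw [d1_d1Section]
      exact hx))

theorem iota_termMk (u : C1 K P.F) (hu : d1 K P.F u ∈ P.RF) :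
    P.iota (P.termMk _ hu) = H1mk _ (P.d1_C1Map_toQuot hu) := by
  refine H1mk_eq_iff.2 ?_
  rw [LinearMap.comp_apply, ← map_sub]
  refine P.C1Map_toQuot_mem_range_d2_of_d1_mem ?_
  rw [map_sub, d1_d1Section, sub_self]
  exact zero_mem _

theorem iota_injective : Function.Injective P.iota := by
  refine (injective_iff_map_eq_zero _).2 fun x hx => ?_
  obtain ⟨u, hu, rfl⟩ := P.exists_termMk x
  rw [iota_termMk, H1mk_eq_zero_iff] at hx
  exact P.termMk_eq_zero_iff.2 (P.d1_mem_of_C1Map_toQuot_mem_range_d2 hx)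

theorem C1Map_toQuot (u : C1 K P.F) :
    C1Map P.toQuot u = C1Map (proj (center K Q)) (C1Map P.rho u) := by
  rw [toQuot, C1Map_comp, LinearMap.comp_apply]

/-- Pushing `u` to `C₁(Q)` gives a lift on which `theta_H1mk` applies, so in terms of `d₁ u` the map
`θ` is just `F → Q`. -/
theorem theta_H1mk_toQuot (u : C1 K P.F) (hu : d1 K _ (C1Map P.toQuot u) = 0) :
    (theta Q (H1mk _ hu) : Q) = P.rho.toLinearMap (d1 K P.F u) := by
  rw [← d1_C1Map, ← theta_H1mk Q (C1Map P.rho u) (by rwa [← C1Map_toQuot])]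
  simp only [C1Map_toQuot]

/-- For a cycle lifted to `u ∈ C₁(F)`, vanishing of `θ` says precisely that `d₁ u ∈ R`, so the class
of `d₁ u` is a preimage. -/
theorem iota_exact : Function.Exact P.iota (theta (K := K) Q) := by
  intro y
  constructor
  · intro hy
    obtain ⟨v, hv, rfl⟩ := exists_H1mk y
    obtain ⟨u, rfl⟩ := C1Map_surjective P.toQuot_surjective v
    have hu : d1 K P.F u ∈ P.RF := by
      refine ⟨?_, range_d1 K P.F ▸ ⟨u, rfl⟩⟩
      change P.rho.toLinearMap (d1 K P.F u) = 0
      rw [← P.theta_H1mk_toQuot u hv, hy]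
      rfl
    exact ⟨P.termMk _ hu, P.iota_termMk u hu⟩
  · rintro ⟨x, rfl⟩
    obtain ⟨u, hu, rfl⟩ := P.exists_termMk x
    refine Subtype.ext ?_
    rw [iota_termMk, theta_H1mk_toQuot]
    exact hu.1

end FreePresentation

/-! ### Naturality of `θ` and `ι` -/

section Naturality

variable {K Q Q' : Type*} [Field K] [AddCommGroup Q] [Module K Q] [AWB K Q]
  [AddCommGroup Q'] [Module K Q'] [AWB K Q'] (f : AWBHom K Q Q')
  (hf : (center K Q).toSubmodule ≤ (center K Q').toSubmodule.comap f.toLinearMap)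

theorem C1Map_quotientMap_proj (u : C1 K Q) :
    C1Map (quotientMap f (center K Q) (center K Q') hf) (C1Map (proj (center K Q)) u)
      = C1Map (proj (center K Q')) (C1Map f u) :=
  C1Map_comm (f := proj (center K Q)) (g := quotientMap f (center K Q) (center K Q') hf)
    (f' := f) (g' := proj (center K Q')) rfl u

theorem theta_naturality :
    derivedMap f ∘ₗ theta Q
      = theta Q' ∘ₗ H1Map (quotientMap f (center K Q) (center K Q') hf) := by
  refine LinearMap.ext fun x => ?_
  obtain ⟨u, hu, rfl⟩ := exists_H1mk_proj Q x
  refine Subtype.ext ?_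
  rw [LinearMap.comp_apply, LinearMap.comp_apply, H1Map_H1mk]
  change f.toLinearMap (theta Q (H1mk _ hu) : Q) = _
  rw [theta_H1mk, ← d1_C1Map]
  simp only [C1Map_quotientMap_proj]
  rw [theta_H1mk]

/-- If `u` represents a class over `F`, then `C1Map g u` represents its image over `F'`, since `d₁`
commutes with `g`. As `iota_termMk` accepts any representing chain, no compatibility between the
chosen sections is needed. -/
theorem FreePresentation.iota_naturality (P : FreePresentation K Q) (P' : FreePresentation K Q')
    (g : AWBHom K P.F P'.F)
    (hg : P'.rho.toLinearMap ∘ₗ g.toLinearMap = f.toLinearMap ∘ₗ P.rho.toLinearMap) :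
    H1Map (quotientMap f (center K Q) (center K Q') hf) ∘ₗ P.iota
      = P'.iota ∘ₗ termMap P P' f hf g hg := by
  refine LinearMap.ext fun x => ?_
  obtain ⟨u, hu, rfl⟩ := P.exists_termMk x
  rw [LinearMap.comp_apply, LinearMap.comp_apply, iota_termMk, H1Map_H1mk]
  have hgu : ∃ h, termMap P P' f hf g hg (P.termMk _ hu) = P'.termMk (g.toLinearMap (d1 K _ u)) h :=
    ⟨_, rfl⟩
  obtain ⟨h, e⟩ := hgu
  rw [e]
  simp only [← d1_C1Map]
  rw [iota_termMk]
  simp only [C1Map_toQuot, C1Map_quotientMap_proj, C1Map_comm hg]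

end Naturality

end AWB

theorem proposition4p4 (K : Type u) [Field K] :
    ∃ (θ : ∀ (Q : Type v) [AddCommGroup Q] [Module K Q] [AWB K Q],
          AWB.H1 K (Q ⧸ (AWB.center K Q).toSubmodule) →ₗ[K] AWB.derived K Q)
      (ι : ∀ (Q : Type v) [AddCommGroup Q] [Module K Q] [AWB K Q]
          (P : AWB.FreePresentation.{u, v, w} K Q),
          P.Term →ₗ[K] AWB.H1 K (Q ⧸ (AWB.center K Q).toSubmodule)),
      -- exactness
      (∀ (Q : Type v) [AddCommGroup Q] [Module K Q] [AWB K Q],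
        (∀ P : AWB.FreePresentation.{u, v, w} K Q,
          Function.Injective (ι Q P) ∧ Function.Exact (ι Q P) (θ Q)) ∧
        Function.Exact (θ Q) (AWB.derivedMap (AWB.proj (AWB.center K Q))) ∧
        Function.Surjective (AWB.derivedMap (AWB.proj (AWB.center K Q)))) ∧
      -- naturality
      (∀ (Q Q' : Type v) [AddCommGroup Q] [Module K Q] [AWB K Q]
        [AddCommGroup Q'] [Module K Q'] [AWB K Q'] (f : AWBHom K Q Q')
        (hf : (AWB.center K Q).toSubmodule ≤ (AWB.center K Q').toSubmodule.comap f.toLinearMap),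
        (∀ (P : AWB.FreePresentation.{u, v, w} K Q) (P' : AWB.FreePresentation.{u, v, w} K Q')
          (g : AWBHom K P.F P'.F)
          (hg : P'.rho.toLinearMap ∘ₗ g.toLinearMap = f.toLinearMap ∘ₗ P.rho.toLinearMap),
          AWB.H1Map (AWB.quotientMap f (AWB.center K Q) (AWB.center K Q') hf) ∘ₗ ι Q P
            = ι Q' P' ∘ₗ AWB.FreePresentation.termMap P P' f hf g hg) ∧
        AWB.derivedMap f ∘ₗ θ Q
          = θ Q' ∘ₗ AWB.H1Map (AWB.quotientMap f (AWB.center K Q) (AWB.center K Q') hf) ∧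
        AWB.derivedMap (AWB.quotientMap f (AWB.center K Q) (AWB.center K Q') hf) ∘ₗ
            AWB.derivedMap (AWB.proj (AWB.center K Q))
          = AWB.derivedMap (AWB.proj (AWB.center K Q')) ∘ₗ AWB.derivedMap f) := by
  refine ⟨fun Q _ _ _ => AWB.theta Q, fun Q _ _ _ P => P.iota, ?_, ?_⟩
  · intro Q _ _ _
    exact ⟨fun P => ⟨P.iota_injective, P.iota_exact⟩, AWB.theta_exact Q,
      AWB.derivedMap_surjective (AWB.proj_surjective Q _)⟩
  · intro Q Q' _ _ _ _ _ _ f hf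
    exact ⟨fun P P' g hg => AWB.FreePresentation.iota_naturality f hf P P' g hg,
      -- In the square of the maps `π'`, both composites send `x` to the class of `f x` by
      -- definition.
      AWB.theta_naturality f hf, rfl⟩
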